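/- For non-negative integers $n,r,s$ let $a_n(r,s)=\sum_{k=0}^n\binom nk^r\binom{n+k}k^s$ be the (generalised) Apéry numbers, and let $\chi(\mathcal S)=1$ if the assertion $\mathcal S$ is true and $\chi(\mathcal S)=0$ otherwise. For all positive integers $r$ and all non-negative integers $n=n_0+3n_1+9n_2+\dots+3^mn_m$, where $0\le n_i\le 2$ for all $i$, we have $$a_n(r,0)\equiv\prod_{i=0}^m a_{n_i}(r,0)+3\sum_{\nu=1}^m\Bigg(\prod_{\substack{0\le i\le m\\ i\ne\nu-1,\nu}}a_{n_i}(r,0)\Bigg)f(n_{\nu-1},n_\nu;r,0)\pmod 9,$$ where $$f(n_{\nu-1},n_\nu;r,0)=\chi(r=1)\big(n_\nu-\chi(n_\nu=2)\big)\big(\chi(n_{\nu-1}=2)-1\big)-r\,\big(n_\nu+(-1)^r\chi(n_\nu=2)\big)\big(\chi(n_{\nu-1}=1)-(-1)^r\chi(n_{\nu-1}=2)\big).$$ -/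

import Mathlib

/-- The (generalised) Apéry numbers `a_n(r,s) = ∑_{k=0}^n (n choose k)^r (n+k choose k)^s`.
For `s = 0` these are the generalised Franel numbers. -/
def aperyNumber (n r s : ℕ) : ℕ :=
  ∑ k ∈ Finset.range (n + 1), n.choose k ^ r * (n + k).choose k ^ s

/-- The truth value `χ(P)`: it is `1` if `P` is true and `0` otherwise. -/
def chi (P : Prop) [Decidable P] : ℤ := if P then 1 else 0

/-- The correction term `f(u, v; r, 0)`, where `u` is a ternary digit and `v` is the next more
significant one. -/
def franelCorrection (u v r : ℕ) : ℤ :=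
  chi (r = 1) * ((v : ℤ) - chi (v = 2)) * (chi (u = 2) - 1)
    - (r : ℤ) * ((v : ℤ) + chi (v = 2) * (-1) ^ r) * (chi (u = 1) - (-1) ^ r * chi (u = 2))

/-!
Write `a n = ∑ k, (n choose k) ^ r` and work in `ZMod 9`. For `v ≤ u ≤ 2` and `j ≤ n`, the binomial
coefficient `(3n+u choose 3j+v)` is `(n choose j) (u choose v)` times some `1 + 3x`, whose `r`-th
power is `1 + 3rx`; for `u < v ≤ 2` it is divisible by `3`, so its `r`-th power vanishes as soon as
`2 ≤ r`. Summing over `k = 3j + v` gives a one-digit recurrence `a (3n+u) = a n * (a u + 3 n g u)`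
with an explicit slope `g`; for `r = 1` it comes from `a n = 2 ^ n`. Now iterate over the digits:
the factor `3 n` only sees the last digit of `n`, and products of two correction terms vanish.
-/

open Finset

section Choose

theorem dvd_choose_mul_of_coprime {m k : ℕ} (h : m.Coprime k) (n : ℕ) : m ∣ (m * n).choose k := by
  cases k with
  | zero => simp [(Nat.coprime_zero_right m).1 h]
  | succ k =>
    cases hN : m * n with
    | zero => simp
    | succ N =>
      refine h.dvd_of_dvd_mul_right ?_
      rw [← Nat.add_one_mul_choose_eq, ← hN, mul_assoc]
      exact dvd_mul_right _ _

theorem sq_dvd_choose_mul_choose {p i k : ℕ} (hp : p.Prime) (hi₀ : i ≠ 0) (hi : i ≠ p)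
    (hik : p ∣ i + k) (n : ℕ) : p ^ 2 ∣ p.choose i * (p * n).choose k := by
  obtain hpi | hip := hi.symm.lt_or_gt
  · simp [Nat.choose_eq_zero_of_lt hpi]
  have hk : ¬ p ∣ k := fun h =>
    Nat.not_dvd_of_pos_of_lt (Nat.pos_of_ne_zero hi₀) hip ((Nat.dvd_add_left h).1 hik)
  rw [sq]
  exact mul_dvd_mul (hp.dvd_choose_self hi₀ hip)
    (dvd_choose_mul_of_coprime ((hp.coprime_iff_not_dvd).2 hk) n)

theorem choose_prime_mul_succ_succ_modEq {p : ℕ} (hp : p.Prime) (n j : ℕ) :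
    (p * (n + 1)).choose (p * (j + 1)) ≡
      (p * n).choose (p * j) + (p * n).choose (p * (j + 1)) [MOD p ^ 2] := by
  have extremes : ∑ ik ∈ {(p, p * j), (0, p * (j + 1))}, p.choose ik.1 * (p * n).choose ik.2
      = (p * n).choose (p * j) + (p * n).choose (p * (j + 1)) := by
    simp [hp.ne_zero]
  rw [← extremes, mul_add_one, add_comm, Nat.add_choose_eq, ← ZMod.natCast_eq_natCast_iff]
  push_cast
  refine (sum_subset ?_ fun ik hik hik' => ?_).symm
  · simp [insert_subset_iff, mul_add_one, add_comm]
  · obtain ⟨i, k⟩ := ik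
    rw [Finset.HasAntidiagonal.mem_antidiagonal] at hik
    rw [← Nat.cast_mul, ZMod.natCast_eq_zero_iff]
    refine sq_dvd_choose_mul_choose hp ?_ ?_ (hik ▸ dvd_mul_right p _) n
    · rintro rfl
      simp_all
    · rintro rfl
      rw [mul_add_one, add_comm] at hik
      simp_all

theorem choose_prime_mul_modEq {p : ℕ} (hp : p.Prime) (n j : ℕ) :
    (p * n).choose (p * j) ≡ n.choose j [MOD p ^ 2] := by
  induction n generalizing j with
  | zero =>
    cases j with
    | zero => simp [Nat.ModEq.refl]
    | succ j => simp [Nat.choose_eq_zero_of_lt (Nat.mul_pos hp.pos j.succ_pos), Nat.ModEq.refl]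
  | succ n ih =>
    cases j with
    | zero => simp [Nat.ModEq.refl]
    | succ j =>
      rw [Nat.choose_succ_succ]
      exact (choose_prime_mul_succ_succ_modEq hp n j).trans ((ih j).add (ih (j + 1)))

end Choose

section ModNine

theorem nine_eq_zero : (9 : ZMod 9) = 0 := rfl

theorem three_mul_natCast_eq_zero {x : ℕ} (h : 3 ∣ x) : 3 * (x : ZMod 9) = 0 :=
  mod_cast (ZMod.natCast_eq_zero_iff (3 * x) 9).2 (mul_dvd_mul_left 3 h)

theorem natCast_pow_eq_zero {x r : ℕ} (h : 3 ∣ x) (hr : 2 ≤ r) : (x : ZMod 9) ^ r = 0 :=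
  mod_cast (ZMod.natCast_eq_zero_iff (x ^ r) 9).2
    ((pow_dvd_pow_of_dvd h 2).trans (pow_dvd_pow x hr))

theorem one_add_pow_of_sq_eq_zero {R : Type*} [CommSemiring R] {x : R} (hx : x ^ 2 = 0) (n : ℕ) :
    (1 + x) ^ n = 1 + n * x := by
  obtain ⟨k, hk⟩ := Polynomial.powAddExpansion 1 x n
  simpa [hx] using hk

theorem one_add_three_mul_pow (x : ZMod 9) (r : ℕ) : (1 + 3 * x) ^ r = 1 + r * (3 * x) :=
  one_add_pow_of_sq_eq_zero (by linear_combination x ^ 2 * nine_eq_zero) r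

theorem three_mul_two_pow (r : ℕ) : (3 : ZMod 9) * 2 ^ r = 3 * (-1) ^ r := by
  rw [show (2 : ZMod 9) = -1 * (1 + 3 * -1) by decide, mul_pow, one_add_three_mul_pow]
  linear_combination -(-1) ^ r * (r : ZMod 9) * nine_eq_zero

theorem natCast_choose_three_mul (n j : ℕ) : ((3 * n).choose (3 * j) : ZMod 9) = n.choose j :=
  (ZMod.natCast_eq_natCast_iff _ _ 9).2 (choose_prime_mul_modEq Nat.prime_three n j)

theorem three_dvd_choose_add_one (n j : ℕ) : 3 ∣ (3 * n).choose (3 * j + 1) :=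
  dvd_choose_mul_of_coprime (by simp) n

theorem three_dvd_choose_add_two (n j : ℕ) : 3 ∣ (3 * n).choose (3 * j + 2) :=
  dvd_choose_mul_of_coprime ((Nat.coprime_mul_left_add_right 3 2 j).2 (by decide)) n

theorem three_dvd_choose_add_one_add_two (n j : ℕ) : 3 ∣ (3 * n + 1).choose (3 * j + 2) :=
  dvd_add (three_dvd_choose_add_one n j) (three_dvd_choose_add_two n j)

theorem natCast_choose_three_mul_add_one (n j : ℕ) :
    ((3 * n).choose (3 * j + 1) : ZMod 9) = n.choose j * (3 * (n - j : ℕ)) := by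
  have absorption := congrArg (Nat.cast : ℕ → ZMod 9) (Nat.choose_succ_right_eq (3 * n) (3 * j))
  rw [← Nat.mul_sub] at absorption
  push_cast at absorption
  rw [natCast_choose_three_mul] at absorption
  linear_combination absorption - j * three_mul_natCast_eq_zero (three_dvd_choose_add_one n j)

theorem natCast_choose_three_mul_add_two (n j : ℕ) :
    ((3 * n).choose (3 * j + 2) : ZMod 9) = (3 * n).choose (3 * j + 1) := by
  have absorption : (3 * n + 1 : ZMod 9) * (3 * n).choose (3 * j + 1)
      = ((3 * n).choose (3 * j + 1) + (3 * n).choose (3 * j + 2)) * (3 * j + 2) := by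
    have h := congrArg (Nat.cast : ℕ → ZMod 9) (Nat.add_one_mul_choose_eq (3 * n) (3 * j + 1))
    rw [Nat.choose_succ_succ] at h
    push_cast at h
    linear_combination h
  linear_combination absorption
    + (1 + j) * three_mul_natCast_eq_zero (three_dvd_choose_add_two n j)
    + (j - n) * three_mul_natCast_eq_zero (three_dvd_choose_add_one n j)

theorem natCast_choose_add_one_three_mul_add_one (n j : ℕ) :
    ((3 * n + 1).choose (3 * j + 1) : ZMod 9) = n.choose j * (1 + 3 * (n - j : ℕ)) := by
  rw [Nat.choose_succ_succ, Nat.cast_add, natCast_choose_three_mul,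
    natCast_choose_three_mul_add_one]
  ring

theorem natCast_choose_add_one_three_mul {n j : ℕ} (h : j ≤ n) :
    ((3 * n + 1).choose (3 * j) : ZMod 9) = n.choose j * (1 + 3 * j) := by
  rw [← Nat.choose_symm_of_eq_add (show 3 * n + 1 = 3 * (n - j) + 1 + 3 * j by omega),
    natCast_choose_add_one_three_mul_add_one, Nat.choose_symm h, Nat.sub_sub_self h]

theorem natCast_choose_add_two_three_mul_add_two (n j : ℕ) :
    ((3 * n + 2).choose (3 * j + 2) : ZMod 9) = n.choose j := by
  rw [Nat.choose_succ_succ, Nat.choose_succ_succ _ (3 * j + 1), Nat.cast_add, Nat.cast_add,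
    natCast_choose_add_one_three_mul_add_one, natCast_choose_three_mul_add_two,
    natCast_choose_three_mul_add_one]
  linear_combination n.choose j * (n - j : ℕ) * nine_eq_zero

theorem natCast_choose_add_two_three_mul {n j : ℕ} (h : j ≤ n) :
    ((3 * n + 2).choose (3 * j) : ZMod 9) = n.choose j := by
  rw [← Nat.choose_symm_of_eq_add (show 3 * n + 2 = 3 * (n - j) + 2 + 3 * j by omega),
    natCast_choose_add_two_three_mul_add_two, Nat.choose_symm h]

theorem natCast_choose_add_two_three_mul_add_one {n j : ℕ} (h : j ≤ n) :
    ((3 * n + 2).choose (3 * j + 1) : ZMod 9) = n.choose j * (2 * (1 + 3 * -n)) := by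
  rw [Nat.choose_succ_succ, Nat.cast_add, natCast_choose_add_one_three_mul h,
    natCast_choose_add_one_three_mul_add_one, Nat.cast_sub h]
  linear_combination n.choose j * (n : ZMod 9) * nine_eq_zero

end ModNine

section Franel

theorem aperyNumber_zero_right (n r : ℕ) :
    aperyNumber n r 0 = ∑ k ∈ range (n + 1), n.choose k ^ r := by
  simp [aperyNumber]

theorem aperyNumber_zero (r : ℕ) : aperyNumber 0 r 0 = 1 := by
  simp [aperyNumber_zero_right]

theorem aperyNumber_one (r : ℕ) : aperyNumber 1 r 0 = 2 := by
  simp [aperyNumber_zero_right, sum_range_succ]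

theorem aperyNumber_two (r : ℕ) : aperyNumber 2 r 0 = 2 + 2 ^ r := by
  simp only [aperyNumber_zero_right, Nat.reduceAdd, sum_range_succ, range_one, sum_singleton,
    Nat.choose_zero_right, one_pow, Nat.choose_succ_self_right, Nat.choose_self]
  ring

theorem aperyNumber_one_zero (n : ℕ) : aperyNumber n 1 0 = 2 ^ n := by
  simp [aperyNumber_zero_right, Nat.sum_range_choose]

theorem aperyNumber_eq_sum_range {n r N : ℕ} (hr : r ≠ 0) (h : n < N) :
    aperyNumber n r 0 = ∑ k ∈ range N, n.choose k ^ r := by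
  rw [aperyNumber_zero_right]
  refine sum_subset (range_mono h) fun k _ hk => ?_
  rw [Nat.choose_eq_zero_of_lt (by simpa using hk), zero_pow hr]

theorem sum_range_mul {M : Type*} [AddCommMonoid M] (f : ℕ → M) (b n : ℕ) :
    ∑ k ∈ range (b * n), f k = ∑ j ∈ range n, ∑ v ∈ range b, f (b * j + v) := by
  induction n with
  | zero => simp
  | succ n ih => rw [mul_add_one, sum_range_add, ih, sum_range_succ]

theorem natCast_aperyNumber_three_mul_add_eq_mul {r u n : ℕ} {c : ZMod 9} (hr : r ≠ 0) (hu : u < 3)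
    (h : ∀ j ≤ n, ∑ v ∈ range 3, ((3 * n + u).choose (3 * j + v) : ZMod 9) ^ r
      = (n.choose j : ZMod 9) ^ r * c) :
    (aperyNumber (3 * n + u) r 0 : ZMod 9) = aperyNumber n r 0 * c := by
  rw [aperyNumber_eq_sum_range hr (show 3 * n + u < 3 * (n + 1) by omega), sum_range_mul,
    aperyNumber_zero_right]
  push_cast
  rw [sum_mul]
  exact sum_congr rfl fun j hj => h j (mem_range_succ_iff.1 hj)

theorem natCast_aperyNumber_three_mul {r : ℕ} (hr : 2 ≤ r) (n : ℕ) :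
    (aperyNumber (3 * n) r 0 : ZMod 9) = aperyNumber n r 0 := by
  rw [← mul_one (aperyNumber n r 0 : ZMod 9)]
  refine natCast_aperyNumber_three_mul_add_eq_mul (u := 0) (by omega) (by omega) fun j _ => ?_
  simp only [sum_range_succ, sum_range_zero, add_zero, zero_add]
  rw [natCast_choose_three_mul, natCast_pow_eq_zero (three_dvd_choose_add_one n j) hr,
    natCast_pow_eq_zero (three_dvd_choose_add_two n j) hr]
  ring

theorem natCast_aperyNumber_three_mul_add_one {r : ℕ} (hr : 2 ≤ r) (n : ℕ) :
    (aperyNumber (3 * n + 1) r 0 : ZMod 9) = aperyNumber n r 0 * (2 + 3 * n * r) := by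
  refine natCast_aperyNumber_three_mul_add_eq_mul (by omega) (by omega) fun j hj => ?_
  simp only [sum_range_succ, sum_range_zero, add_zero, zero_add]
  rw [natCast_choose_add_one_three_mul hj, natCast_choose_add_one_three_mul_add_one,
    natCast_pow_eq_zero (three_dvd_choose_add_one_add_two n j) hr, mul_pow, mul_pow,
    one_add_three_mul_pow, one_add_three_mul_pow, Nat.cast_sub hj]
  ring

theorem natCast_aperyNumber_three_mul_add_two {r : ℕ} (hr : r ≠ 0) (n : ℕ) :
    (aperyNumber (3 * n + 2) r 0 : ZMod 9)
      = aperyNumber n r 0 * (2 + 2 ^ r + 3 * n * -(r * (-1) ^ r)) := by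
  refine natCast_aperyNumber_three_mul_add_eq_mul hr (by omega) fun j hj => ?_
  simp only [sum_range_succ, sum_range_zero, add_zero, zero_add]
  rw [natCast_choose_add_two_three_mul hj, natCast_choose_add_two_three_mul_add_one hj,
    natCast_choose_add_two_three_mul_add_two, mul_pow, mul_pow, one_add_three_mul_pow]
  linear_combination -(n.choose j : ZMod 9) ^ r * r * n * three_mul_two_pow r

/-- The slope `g` in the congruence `a (3n+u) ≡ a n * (a u + 3 n g) (mod 9)` for the generalised
Franel numbers `a n = aperyNumber n r 0`, with `u` a ternary digit. It only matters modulo `3`; this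
representative is the common factor of the terms of `franelCorrection`. -/
def franelSlope (u r : ℕ) : ℤ :=
  chi (r = 1) * (1 - chi (u = 2)) + r * (chi (u = 1) - (-1) ^ r * chi (u = 2))

theorem franelCorrection_eq_mul_franelSlope (u v r : ℕ) :
    franelCorrection u v r = -(v + (-1) ^ r * chi (v = 2)) * franelSlope u r := by
  obtain rfl | hr := eq_or_ne r 1
  · simp only [franelCorrection, franelSlope]
    ring
  · simp only [franelCorrection, franelSlope, chi, if_neg hr]
    ring

theorem natCast_aperyNumber_three_mul_add {r u : ℕ} (hr : 1 ≤ r) (hu : u < 3) (n : ℕ) :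
    (aperyNumber (3 * n + u) r 0 : ZMod 9)
      = aperyNumber n r 0 * (aperyNumber u r 0 + 3 * n * (franelSlope u r : ZMod 9)) := by
  obtain rfl | hr₂ := hr.eq_or_lt
  · have slope : (3 : ZMod 9) * franelSlope u 1 = 3 * 2 ^ u := by
      interval_cases u <;> decide
    simp only [aperyNumber_one_zero, Nat.cast_pow, Nat.cast_ofNat]
    rw [pow_add, pow_mul, show (2 : ZMod 9) ^ 3 = 2 * (1 + 3 * 1) by decide, mul_pow,
      one_add_three_mul_pow]
    linear_combination -(2 : ZMod 9) ^ n * n * slope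
  interval_cases u
  · simp [natCast_aperyNumber_three_mul hr₂, aperyNumber_zero, franelSlope, chi, hr₂.ne']
  · simp [natCast_aperyNumber_three_mul_add_one hr₂, aperyNumber_one, franelSlope, chi, hr₂.ne']
  · simp [natCast_aperyNumber_three_mul_add_two (by omega : r ≠ 0), aperyNumber_two, franelSlope,
      chi, hr₂.ne']

theorem three_mul_mul_aperyNumber_self {v : ℕ} (hv : v < 3) (r : ℕ) :
    3 * (v * aperyNumber v r 0 : ZMod 9) = 3 * -(v + (-1) ^ r * chi (v = 2)) := by
  interval_cases v
  · simp [chi]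
  · rw [aperyNumber_one]
    simp only [Nat.cast_one, Nat.cast_ofNat, one_mul, chi, OfNat.one_ne_ofNat, ↓reduceIte,
      Int.cast_zero, mul_zero, add_zero]
    decide
  · rw [aperyNumber_two]
    simp only [Nat.cast_ofNat, Nat.cast_add, Nat.cast_pow, chi, ↓reduceIte, Int.cast_one, mul_one]
    linear_combination 2 * three_mul_two_pow r + (2 + (-1) ^ r) * nine_eq_zero

theorem three_mul_franelCorrection {v : ℕ} (hv : v < 3) (u r : ℕ) :
    3 * (franelCorrection u v r : ZMod 9)
      = 3 * (aperyNumber v r 0 * (v * (franelSlope u r : ZMod 9))) := by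
  rw [franelCorrection_eq_mul_franelSlope]
  push_cast
  linear_combination -(franelSlope u r : ZMod 9) * three_mul_mul_aperyNumber_self hv r

end Franel

section Digits

theorem prod_erase_zero_range_succ {M : Type*} [CommMonoid M] (f : ℕ → M) (m : ℕ) :
    ∏ i ∈ (range (m + 1)).erase 0, f i = ∏ i ∈ range m, f (i + 1) := by
  rw [← filter_ne', prod_filter, prod_range_succ']
  simp

theorem prod_erase_succ_range_succ {M : Type*} [CommMonoid M] (f : ℕ → M) (m ν : ℕ) :
    ∏ i ∈ (range (m + 1)).erase (ν + 1), f i = (∏ i ∈ (range m).erase ν, f (i + 1)) * f 0 := by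
  rw [← filter_ne', ← filter_ne', prod_filter, prod_filter, prod_range_succ']
  simp

theorem prod_erase_eq_prod_filter_mul {ι M : Type*} [DecidableEq ι] [CommMonoid M] (f : ι → M)
    {s : Finset ι} {a b : ι} (hb : b ∈ s) (hab : b ≠ a) :
    ∏ i ∈ s.erase a, f i = (∏ i ∈ s with i ≠ a ∧ i ≠ b, f i) * f b := by
  rw [← prod_erase_mul _ _ (mem_erase.2 ⟨hab, hb⟩)]
  congr 2
  grind

theorem sum_digits_succ (d : ℕ → ℕ) (b m : ℕ) :
    ∑ i ∈ range (m + 1), d i * b ^ i = b * ∑ i ∈ range m, d (i + 1) * b ^ i + d 0 := by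
  rw [sum_range_succ', mul_sum, pow_zero, mul_one]
  exact congrArg (· + d 0) (sum_congr rfl fun i _ => by ring)

theorem apply_sum_digits {R : Type*} [CommRing R] {A g : ℕ → R} {b : ℕ} (hb : (b : R) ^ 2 = 0)
    (hA : ∀ n, ∀ u < b, A (b * n + u) = A n * (A u + b * n * g u)) (m : ℕ) (d : ℕ → ℕ)
    (hd : ∀ i ≤ m, d i < b) :
    A (∑ i ∈ range (m + 1), d i * b ^ i) = ∏ i ∈ range (m + 1), A (d i)
      + b * ∑ ν ∈ range m,
          (∏ i ∈ (range (m + 1)).erase ν, A (d i)) * (d (ν + 1) * g (d ν)) := by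
  induction m generalizing d with
  | zero => simp
  | succ m ih =>
    have ih' := ih (fun i => d (i + 1)) fun i hi => hd (i + 1) (by omega)
    have last_digit : (b : R) * (∑ i ∈ range (m + 1), d (i + 1) * b ^ i : ℕ) = b * d 1 := by
      rw [sum_digits_succ (fun i => d (i + 1))]
      push_cast
      linear_combination (∑ i ∈ range m, (d (i + 1 + 1) : R) * b ^ i) * hb
    rw [sum_digits_succ, hA _ _ (hd 0 (by omega))]
    set N := ∑ i ∈ range (m + 1), d (i + 1) * b ^ i
    rw [prod_range_succ', sum_range_succ', prod_erase_zero_range_succ]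
    simp only [prod_erase_succ_range_succ, mul_right_comm _ (A (d 0)), ← sum_mul]
    set S := ∑ ν ∈ range m, (∏ i ∈ (range (m + 1)).erase ν, A (d (i + 1)))
      * (d (ν + 1 + 1) * g (d (ν + 1)))
    linear_combination (A (d 0) + b * d 1 * g (d 0)) * ih' + A N * g (d 0) * last_digit
      + S * d 1 * g (d 0) * hb

end Digits

theorem theorem2 (r : ℕ) (hr : 1 ≤ r) (m n : ℕ) (d : ℕ → ℕ)
    (hd : ∀ i ≤ m, d i ≤ 2)
    (hn : n = ∑ i ∈ Finset.range (m + 1), d i * 3 ^ i) :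
    (aperyNumber n r 0 : ℤ) ≡
      ∏ i ∈ Finset.range (m + 1), (aperyNumber (d i) r 0 : ℤ)
        + 3 * ∑ ν ∈ Finset.Icc 1 m,
            (∏ i ∈ (Finset.range (m + 1)).filter (fun i => i ≠ ν - 1 ∧ i ≠ ν),
              (aperyNumber (d i) r 0 : ℤ))
            * franelCorrection (d (ν - 1)) (d ν) r [ZMOD 9] := by
  refine (ZMod.intCast_eq_intCast_iff _ _ 9).1 ?_
  have hd' (i : ℕ) (hi : i ≤ m) : d i < 3 := Nat.lt_succ_of_le (hd i hi)
  have expansion := apply_sum_digits (R := ZMod 9) (A := fun n => aperyNumber n r 0)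
    (g := fun u => franelSlope u r) (b := 3) (by decide)
    (fun n u hu => natCast_aperyNumber_three_mul_add hr hu n) m d hd'
  rw [← hn] at expansion
  rw [← Finset.Ico_add_one_right_eq_Icc, Finset.sum_Ico_eq_sum_range]
  simp only [Nat.add_sub_cancel, add_comm 1]
  push_cast
  refine expansion.trans (congrArg _ ?_)
  rw [Nat.cast_ofNat, mul_sum, mul_sum]
  refine sum_congr rfl fun ν hν => ?_
  have hν' : ν + 1 ≤ m := mem_range.1 hν
  rw [prod_erase_eq_prod_filter_mul _ (mem_range_succ_iff.2 hν') ν.succ_ne_self]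
  linear_combination
    -(∏ i ∈ range (m + 1) with i ≠ ν ∧ i ≠ ν + 1, (aperyNumber (d i) r 0 : ZMod 9))
      * three_mul_franelCorrection (hd' (ν + 1) hν') (d ν) r
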